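/- Let $R$ be a commutative Noetherian ring with $1\neq 0$, let $I$ be a proper ideal of $R$, and let $M,N$ be $R$-modules with $M$ finitely generated ($N$ is arbitrary). For $i\ge 0$ let $$H^i_I(M,N)=\varinjlim_q \operatorname{Ext}^i_R(M/I^qM,N),$$ where the direct system is induced by the natural maps $M/I^{q+1}M\to M/I^qM$, and let $H^i_I(N)=H^i_I(R,N)$. Put $$\operatorname{depth}_I N=\inf\{i\ge 0\mid H^i_I(N)\ne 0\},\qquad \operatorname{cd}_I N=\sup\{i\ge 0\mid H^i_I(N)\neq 0\},$$ $$\operatorname{cd}_I(M,N)=\sup\{i\ge 0\mid H^i_I(M,N)\neq 0\},\qquad e_R(M,L)=\sup\{i\ge 0\mid \operatorname{Ext}^i_R(M,L)\ne 0\}$$ for any $R$-module $L$, and $$h_I(M,N)=\sup_{q\ge 0} e_R(M,H^q_I(N)).$$ Suprema and infima are taken in $\{-\infty\}\cup\mathbb{N}\cup\{+\infty\}$, with $\sup\emptyset=-\infty$, $\inf\emptyset=+\infty$ and $-\infty+x=x+(-\infty)=-\infty$ for all $x$. If $N$ is Cohen–Macaulay with respect to $I$, that is, $\operatorname{depth}_I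 N=\operatorname{cd}_I N$, then $$\operatorname{cd}_I(M,N)=\operatorname{cd}_I N+h_I(M,N).$$ In particular, if $H^i_I(M,N)\neq 0$ for some $i\ge 0$, then $\operatorname{cd}_I(M,N)\ge \operatorname{cd}_I N$. -/

import Mathlib

open CategoryTheory

universe u

noncomputable section

namespace RelCM

variable {R : Type u} [CommRing R]

/-- The `R`-module `Ext_R^i(M, N)`. -/
abbrev ExtMod (R : Type u) [CommRing R] (M N : Type u) [AddCommGroup M] [Module R M]
    [AddCommGroup N] [Module R N] (i : ℕ) : Type u :=
  Abelian.Ext (ModuleCat.of R M) (ModuleCat.of R N) i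

/-- The map `Ext_R^i(M / I^p M, N) → Ext_R^i(M / I^q M, N)`, for `p ≤ q`, induced by the natural
surjection `M / I^q M → M / I^p M`. -/
def extTransition (I : Ideal R) (M N : Type u) [AddCommGroup M] [Module R M]
    [AddCommGroup N] [Module R N] (i p q : ℕ) (h : p ≤ q) :
    ExtMod R (M ⧸ (I ^ p • ⊤ : Submodule R M)) N i →ₗ[R]
      ExtMod R (M ⧸ (I ^ q • ⊤ : Submodule R M)) N i :=
  (Abelian.Ext.mk₀ (ModuleCat.ofHom (Submodule.factorPow I M h))).precompOfLinear R
    (ModuleCat.of R N) (zero_add i)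

/-- The generalized local cohomology module `H^i_I(M, N) = colim_q Ext_R^i(M / I^q M, N)`. -/
abbrev GenLocalCohomology (I : Ideal R) (M N : Type u) [AddCommGroup M] [Module R M]
    [AddCommGroup N] [Module R N] (i : ℕ) : Type u :=
  Module.DirectLimit (fun q : ℕ => ExtMod R (M ⧸ (I ^ q • ⊤ : Submodule R M)) N i)
    (extTransition I M N i)

/-- The local cohomology module `H^i_I(N) = H^i_I(R, N) = colim_q Ext_R^i(R / I^q, N)`. -/
abbrev LocalCohomologyMod (I : Ideal R) (N : Type u) [AddCommGroup N] [Module R N]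
    (i : ℕ) : Type u :=
  GenLocalCohomology I R N i

/-- The cohomological dimension of the pair, `cd_I(M, N) = sup {i ≥ 0 | H^i_I(M, N) ≠ 0}`,
with `sup ∅ = ⊥` (that is, `-∞`). -/
def cdPair (I : Ideal R) (M N : Type u) [AddCommGroup M] [Module R M]
    [AddCommGroup N] [Module R N] : WithBot ℕ∞ :=
  ⨆ (i : ℕ) (_ : Nontrivial (GenLocalCohomology I M N i)), ((i : ℕ∞) : WithBot ℕ∞)

/-- The cohomological dimension `cd_I N = sup {i ≥ 0 | H^i_I(N) ≠ 0}`, with `sup ∅ = ⊥`. -/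
def cd (I : Ideal R) (N : Type u) [AddCommGroup N] [Module R N] : WithBot ℕ∞ :=
  ⨆ (i : ℕ) (_ : Nontrivial (LocalCohomologyMod I N i)), ((i : ℕ∞) : WithBot ℕ∞)

/-- The depth `depth_I N = inf {i ≥ 0 | H^i_I(N) ≠ 0}`, with `inf ∅ = ⊤` (that is, `+∞`). -/
def depth (I : Ideal R) (N : Type u) [AddCommGroup N] [Module R N] : WithBot ℕ∞ :=
  ⨅ (i : ℕ) (_ : Nontrivial (LocalCohomologyMod I N i)), ((i : ℕ∞) : WithBot ℕ∞)

/-- `N` is (relative) Cohen-Macaulay with respect to `I`. -/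
def IsCohenMacaulay (I : Ideal R) (N : Type u) [AddCommGroup N] [Module R N] : Prop :=
  depth I N = cd I N

/-- `e_R(M, N) = sup {i ≥ 0 | Ext_R^i(M, N) ≠ 0}`, with `sup ∅ = ⊥`. -/
def extDim (R : Type u) [CommRing R] (M N : Type u) [AddCommGroup M] [Module R M]
    [AddCommGroup N] [Module R N] : WithBot ℕ∞ :=
  ⨆ (i : ℕ) (_ : Nontrivial (ExtMod R M N i)), ((i : ℕ∞) : WithBot ℕ∞)

/-- `h_I(M, N) = sup_{q ≥ 0} e_R(M, H^q_I(N))`. -/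
def hInv (I : Ideal R) (M N : Type u) [AddCommGroup M] [Module R M]
    [AddCommGroup N] [Module R N] : WithBot ℕ∞ :=
  ⨆ q : ℕ, extDim R M (LocalCohomologyMod I N q)

end RelCM

end

/-! Equality of depth and cohomological dimension forces `H^j_I(N)` to vanish except in one degree
`n`. The Grothendieck spectral sequence `Ext^p(M, H^q_I(N)) ⇒ H^{p+q}_I(M, N)` then collapses, so
`H^{i+n}_I(M, N)` corresponds to `Ext^i(M, H^n_I(N))` and nothing survives below degree `n`. Taking
suprema gives the formula.

The collapse is proved by dimension shifting, and only for vanishing, which is all the suprema need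
(`genLocalCohomology_of_concentrated`). If `n > 0`, then `Γ_I(N) = 0`, and `N` embeds into an
injective `E` with `Γ_I(E) = 0`. All `H^i_I(-, E)` vanish, so passing to `E/N` lowers every degree
by one.

If `n = 0`, embed `N` into any injective `E` with cokernel `C`. Since `H^1_I(N) = 0`, the sequence
`0 → Γ_I(N) → Γ_I(E) → Γ_I(C) → 0` is exact, and `Γ_I(E)` is injective by Artin–Rees. Hence
`H^i_I(M, -)` and `Ext^i(M, Γ_I(-))` shift in parallel, starting from `H^0_I(M, N) = Hom(M,
Γ_I(N))`, which uses that `M` is finite. -/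

noncomputable section

namespace RelCM

open Abelian

variable {R : Type u} [CommRing R]

/-! ### Torsion submodules and injective modules. -/

section Torsion

/-- The `I`-torsion submodule `Γ_I(N)`: the elements annihilated by a power of `I`. -/
def powTorsion (I : Ideal R) (N : Type*) [AddCommGroup N] [Module R N] : Submodule R N where
  carrier := {x | ∃ q : ℕ, ∀ a ∈ I ^ q, a • x = 0}
  zero_mem' := ⟨0, fun a _ => smul_zero a⟩
  add_mem' := by
    rintro x y ⟨p, hp⟩ ⟨q, hq⟩
    refine ⟨p + q, fun a ha => ?_⟩
    rw [smul_add, hp a (Ideal.pow_le_pow_right (Nat.le_add_right p q) ha),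
      hq a (Ideal.pow_le_pow_right (Nat.le_add_left q p) ha), add_zero]
  smul_mem' := by
    rintro c x ⟨q, hq⟩
    exact ⟨q, fun a ha => by rw [smul_comm, hq a ha, smul_zero]⟩

variable (I : Ideal R) {M N P : Type u} [AddCommGroup M] [Module R M] [AddCommGroup N] [Module R N]
  [AddCommGroup P] [Module R P]

theorem mem_powTorsion {x : N} : x ∈ powTorsion I N ↔ ∃ q : ℕ, ∀ a ∈ I ^ q, a • x = 0 := Iff.rfl

theorem map_mem_powTorsion (f : N →ₗ[R] P) {x : N} (hx : x ∈ powTorsion I N) :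
    f x ∈ powTorsion I P := by
  obtain ⟨q, hq⟩ := hx
  exact ⟨q, fun a ha => by rw [← map_smul, hq a ha, map_zero]⟩

theorem mem_powTorsion_of_injective (f : N →ₗ[R] P) (hf : Function.Injective f) {x : N}
    (hx : f x ∈ powTorsion I P) : x ∈ powTorsion I N := by
  obtain ⟨q, hq⟩ := hx
  exact ⟨q, fun a ha => hf (by rw [map_smul, hq a ha, map_zero])⟩

/-- The restriction of a linear map to the `I`-torsion submodules. -/
def powTorsionMap (f : N →ₗ[R] P) : powTorsion I N →ₗ[R] powTorsion I P :=
  f.restrict fun _ hx => map_mem_powTorsion I f hx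

/-- A linear map from a finite module into the `I`-torsion kills `I ^ q M` for some `q`. -/
theorem exists_pow_smul_eq_zero [Module.Finite R M] (f : M →ₗ[R] N)
    (hf : ∀ x, f x ∈ powTorsion I N) : ∃ q : ℕ, ∀ a ∈ I ^ q, ∀ x, a • f x = 0 := by
  obtain ⟨s, hs⟩ := (Module.Finite.fg_top : (⊤ : Submodule R M).FG)
  choose q hq using fun x => (mem_powTorsion I).1 (hf x)
  refine ⟨s.sup q, fun a ha x => ?_⟩
  have hx : x ∈ Submodule.span R (s : Set M) := hs ▸ Submodule.mem_top
  induction hx using Submodule.span_induction with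
  | mem x hx => exact hq x a (Ideal.pow_le_pow_right (Finset.le_sup hx) ha)
  | zero => simp
  | add x y _ _ hx hy => rw [map_add, smul_add, hx, hy, add_zero]
  | smul c x _ hx => rw [map_smul, smul_comm, hx, smul_zero]

theorem injective_of_retract [Module.Injective R P] (s : N →ₗ[R] P) (p : P →ₗ[R] N)
    (h : ∀ x, p (s x) = x) : Module.Injective R N where
  out X Y _ _ _ _ f hf g := by
    obtain ⟨k, hk⟩ := Module.Injective.out f hf (s ∘ₗ g)
    exact ⟨p ∘ₗ k, fun x => by simp [hk, h]⟩

/-- Over a noetherian ring, the `I`-torsion of an injective module is injective. -/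
theorem injective_powTorsion [IsNoetherianRing R] [Module.Injective R N] :
    Module.Injective R (powTorsion I N) := by
  refine Module.Baer.injective fun J g => ?_
  obtain ⟨q, hq⟩ := exists_pow_smul_eq_zero I ((powTorsion I N).subtype ∘ₗ g) fun x => (g x).2
  -- Artin–Rees: `I^(q+k) ∩ J ⊆ I^q J`, which `g` kills. So `g` factors through a submodule of `R /
  -- I^(q+k)`, and any extension to that quotient has torsion values.
  obtain ⟨k, hk⟩ := I.exists_pow_inf_eq_pow_smul (M := R) J
  have hker : Submodule.comap J.subtype (I ^ (q + k)) ≤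
      LinearMap.ker ((powTorsion I N).subtype ∘ₗ g) := by
    intro x hx
    have hx' : (x : R) ∈ I ^ q • (J : Submodule R R) := by
      have h1 : (x : R) ∈ I ^ (q + k) • (⊤ : Submodule R R) ⊓ J :=
        ⟨by simpa using hx, x.2⟩
      rw [hk (q + k) (Nat.le_add_left k q), Nat.add_sub_cancel] at h1
      exact Submodule.smul_mono le_rfl inf_le_right h1
    have hx'' : x ∈ I ^ q • (⊤ : Submodule R J) := by
      have h2 : I ^ q • (J : Submodule R R) =
          Submodule.map (Submodule.subtype J) (I ^ q • ⊤) := by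
        rw [Submodule.map_smul'', Submodule.map_subtype_top]
      rw [h2] at hx'
      obtain ⟨y, hy, hyx⟩ := hx'
      rwa [← Subtype.ext hyx]
    clear hx hx'
    induction hx'' using Submodule.smul_induction_on' with
    | smul r hr n _ => rw [LinearMap.mem_ker, map_smul, hq r hr]
    | add x _ y _ hx hy => exact add_mem hx hy
  let f : J ⧸ Submodule.comap J.subtype (I ^ (q + k)) →ₗ[R] R ⧸ (I ^ (q + k) : Submodule R R) :=
    Submodule.mapQ _ _ J.subtype le_rfl
  have hf : Function.Injective f := by
    rw [← LinearMap.ker_eq_bot, Submodule.ker_mapQ, Submodule.mkQ_map_self]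
  obtain ⟨e, he⟩ := Module.Injective.out f hf (Submodule.liftQ _ _ hker)
  have hmem : ∀ r : R, e (Submodule.Quotient.mk r) ∈ powTorsion I N := fun r =>
    ⟨q + k, fun a ha => by
      rw [← map_smul, ← Submodule.Quotient.mk_smul,
        (Submodule.Quotient.mk_eq_zero (I ^ (q + k)) (x := a • r)).2 (Ideal.mul_mem_right r _ ha),
        map_zero]⟩
  refine ⟨(e ∘ₗ Submodule.mkQ _).codRestrict _ hmem, fun x hx => Subtype.ext ?_⟩
  exact he (Submodule.Quotient.mk ⟨x, hx⟩)

/-- Every module embeds into an injective module. -/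
theorem exists_injective_embedding (N : Type u) [AddCommGroup N] [Module R N] :
    ∃ (E : Type u) (_ : AddCommGroup E) (_ : Module R E) (f : N →ₗ[R] E),
      Module.Injective R E ∧ Function.Injective f :=
  ⟨(Injective.under (ModuleCat.of R N) : ModuleCat.{u} R), inferInstance, inferInstance,
    (Injective.ι (ModuleCat.of R N)).hom,
    Module.injective_module_of_injective_object R _ (inj := inferInstanceAs
      (Injective (Injective.under (ModuleCat.of R N)))),
    (ModuleCat.mono_iff_injective _).1 inferInstance⟩

/-- Over a noetherian ring, a module without `I`-torsion embeds into an injective module without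
`I`-torsion. -/
theorem exists_injective_embedding_of_powTorsion_eq_bot [IsNoetherianRing R]
    (hN : powTorsion I N = ⊥) :
    ∃ (E : Type u) (_ : AddCommGroup E) (_ : Module R E) (f : N →ₗ[R] E),
      Module.Injective R E ∧ Function.Injective f ∧ powTorsion I E = ⊥ := by
  obtain ⟨E, _, _, f, hE, hf⟩ := exists_injective_embedding (R := R) N
  have := injective_powTorsion I (N := E)
  -- `Γ_I(E)` is injective, so it splits off `E`; the complement `ker r` is the required injective
  -- module.
  obtain ⟨r, hr⟩ := Module.Injective.out (powTorsion I E).subtype Subtype.val_injective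
    LinearMap.id
  have hr' : ∀ x : E, r (r x) = r x := fun x => hr (r x)
  let p : E →ₗ[R] LinearMap.ker r :=
    (LinearMap.id - (powTorsion I E).subtype ∘ₗ r).codRestrict _ fun x => by simp [hr']
  refine ⟨LinearMap.ker r, inferInstance, inferInstance, p ∘ₗ f,
    injective_of_retract (LinearMap.ker r).subtype p fun x => Subtype.ext ?_, ?_, ?_⟩
  · have h2 : r (x : E) = 0 := x.2
    change (x : E) - r (x : E) = x
    rw [h2, ZeroMemClass.coe_zero, sub_zero]
  · rw [injective_iff_map_eq_zero]
    intro x hx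
    have h1 : f x = r (f x) := sub_eq_zero.1 (congrArg Subtype.val hx)
    have h2 : x ∈ powTorsion I N := mem_powTorsion_of_injective I f hf (h1 ▸ (r (f x)).2)
    simpa [hN] using h2
  · rw [eq_bot_iff]
    intro x hx
    have h1 := hr ⟨x, map_mem_powTorsion I (LinearMap.ker r).subtype hx⟩
    have h2 : r (x : E) = 0 := x.2
    exact Subtype.ext ((congrArg Subtype.val h1).symm.trans (congrArg Subtype.val h2))

end Torsion

/-! ### Long exact sequences for generalized local cohomology and Ext. -/

section LongExactSequence

variable (I : Ideal R) (M : Type u) [AddCommGroup M] [Module R M]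
  {N A B C : Type u} [AddCommGroup N] [Module R N] [AddCommGroup A] [Module R A]
  [AddCommGroup B] [Module R B] [AddCommGroup C] [Module R C]

theorem extTransition_apply (i p q : ℕ) (h : p ≤ q)
    (x : ExtMod R (M ⧸ (I ^ p • ⊤ : Submodule R M)) N i) :
    extTransition I M N i p q h x =
      (Ext.mk₀ (ModuleCat.ofHom (Submodule.factorPow I M h))).comp x (zero_add i) := rfl

theorem extTransition_self (i q : ℕ) (x : ExtMod R (M ⧸ (I ^ q • ⊤ : Submodule R M)) N i) :
    extTransition I M N i q q le_rfl x = x := by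
  have h : ModuleCat.ofHom (Submodule.factorPow I M (le_refl q)) = 𝟙 _ :=
    ModuleCat.hom_ext (Submodule.linearMap_qext _ rfl)
  rw [extTransition_apply, h, Ext.mk₀_id_comp]

theorem ofHom_factorPow_comp {p q r : ℕ} (hpq : p ≤ q) (hqr : q ≤ r) :
    ModuleCat.ofHom (Submodule.factorPow I M hqr) ≫
        ModuleCat.ofHom (Submodule.factorPow I M hpq) =
      ModuleCat.ofHom (Submodule.factorPow I M (hpq.trans hqr)) := by
  rw [← ModuleCat.ofHom_comp, Submodule.factor_comp]

theorem extTransition_trans (i : ℕ) {p q r : ℕ} (hpq : p ≤ q) (hqr : q ≤ r)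
    (x : ExtMod R (M ⧸ (I ^ p • ⊤ : Submodule R M)) N i) :
    extTransition I M N i q r hqr (extTransition I M N i p q hpq x) =
      extTransition I M N i p r (hpq.trans hqr) x :=
  (Ext.mk₀_comp_mk₀_assoc _ _ _).trans <|
    congrArg (fun z => (Ext.mk₀ z).comp x (zero_add i)) (ofHom_factorPow_comp I M hpq hqr)

instance directedSystem_extTransition (i : ℕ) :
    DirectedSystem (fun q : ℕ => ExtMod R (M ⧸ (I ^ q • ⊤ : Submodule R M)) N i)
      (extTransition I M N i · · ·) where
  map_self _ x := extTransition_self I M i _ x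
  map_map _ _ _ hpq hqr x := extTransition_trans I M i hpq hqr x

/-- The map from a term of the direct system to the generalized local cohomology module. -/
abbrev GenLocalCohomology.of (i q : ℕ) :
    ExtMod R (M ⧸ (I ^ q • ⊤ : Submodule R M)) N i →ₗ[R] GenLocalCohomology I M N i :=
  Module.DirectLimit.of R ℕ _ (extTransition I M N i) q

/-- The map `H^a_I(M, A) → H^b_I(M, B)` given by Yoneda product with a class in `Ext^n(A, B)`. -/
def yoneda {n : ℕ} (α : ExtMod R A B n) {a b : ℕ} (h : a + n = b) :
    GenLocalCohomology I M A a →ₗ[R] GenLocalCohomology I M B b :=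
  Module.DirectLimit.map (fun q => α.postcompOfLinear R _ h) fun p q hpq => by
    ext x
    exact Ext.comp_assoc _ _ _ (zero_add a) h (by lia)

theorem yoneda_of {n : ℕ} (α : ExtMod R A B n) {a b : ℕ} (h : a + n = b) (q : ℕ)
    (x : ExtMod R (M ⧸ (I ^ q • ⊤ : Submodule R M)) A a) :
    yoneda I M α h (GenLocalCohomology.of I M a q x) =
      GenLocalCohomology.of I M b q (x.comp α h) :=
  Module.DirectLimit.map_apply_of _ _ _

variable {I M} in
theorem GenLocalCohomology.exists_of {i : ℕ} (z : GenLocalCohomology I M N i) :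
    ∃ q x, GenLocalCohomology.of I M i q x = z :=
  Module.DirectLimit.exists_of z

/-- Exactness of a sequence of generalized local cohomology modules follows from exactness at each
level of the direct systems. -/
theorem exact_yoneda {m n : ℕ} (α : ExtMod R A B m) (β : ExtMod R B C n) {a b c : ℕ}
    (hα : a + m = b) (hβ : b + n = c)
    (h0 : α.comp β rfl = 0)
    (hex : ∀ (X : ModuleCat.{u} R) (x : Ext X (ModuleCat.of R B) b), x.comp β hβ = 0 →
      ∃ y : Ext X (ModuleCat.of R A) a, y.comp α hα = x) :
    Function.Exact (yoneda I M α hα) (yoneda I M β hβ) := by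
  intro z
  constructor
  · intro hz
    obtain ⟨q, x, rfl⟩ := z.exists_of
    rw [yoneda_of] at hz
    -- A class that dies in the colimit dies at some later stage `r`, where exactness for Ext
    -- applies.
    obtain ⟨r, hqr, hr⟩ := Module.DirectLimit.of.zero_exact hz
    rw [extTransition_apply, ← Ext.comp_assoc _ _ _ (zero_add b) hβ (by lia)] at hr
    obtain ⟨y, hy⟩ := hex _ _ hr
    refine ⟨GenLocalCohomology.of I M a r y, ?_⟩
    rw [yoneda_of, hy]
    exact Module.DirectLimit.of_f
  · rintro ⟨y, rfl⟩
    obtain ⟨q, x, rfl⟩ := y.exists_of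
    rw [yoneda_of, yoneda_of, Ext.comp_assoc x α β hα rfl (by lia), h0, Ext.comp_zero, map_zero]

/-- The map `H^i_I(M, A) → H^i_I(M, B)` induced by a linear map `A → B`. -/
abbrev coeffMap (f : A →ₗ[R] B) (i : ℕ) :
    GenLocalCohomology I M A i →ₗ[R] GenLocalCohomology I M B i :=
  yoneda I M (Ext.mk₀ (ModuleCat.ofHom f)) (add_zero i)

/-- The short complex of modules given by an exact pair of linear maps. -/
abbrev shortComplexOfExact {f : A →ₗ[R] B} {g : B →ₗ[R] C} (hfg : Function.Exact f g) :
    ShortComplex (ModuleCat.{u} R) :=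
  ModuleCat.shortComplexOfCompEqZero f g hfg.linearMap_comp_eq_zero

theorem shortExact_shortComplexOfExact {f : A →ₗ[R] B} {g : B →ₗ[R] C}
    (hf : Function.Injective f) (hfg : Function.Exact f g) (hg : Function.Surjective g) :
    (shortComplexOfExact hfg).ShortExact :=
  ModuleCat.shortComplex_shortExact _ hfg hf hg

variable {f : A →ₗ[R] B} {g : B →ₗ[R] C}

/-- The connecting map `H^i_I(M, C) → H^{i+1}_I(M, A)`. -/
abbrev connecting (hf : Function.Injective f) (hfg : Function.Exact f g)
    (hg : Function.Surjective g) (i : ℕ) : GenLocalCohomology I M C i →ₗ[R] GenLocalCohomology I M A (i + 1) :=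
  yoneda I M (A := C) (B := A) (shortExact_shortComplexOfExact hf hfg hg).extClass rfl

theorem exact_coeffMap_connecting (hf : Function.Injective f) (hfg : Function.Exact f g)
    (hg : Function.Surjective g) (i : ℕ) :
    Function.Exact (coeffMap I M g i) (connecting I M hf hfg hg i) :=
  exact_yoneda I M _ _ _ _ (shortExact_shortComplexOfExact hf hfg hg).comp_extClass fun X x hx =>
    Ext.covariant_sequence_exact₃ X (shortExact_shortComplexOfExact hf hfg hg) x rfl hx

theorem exact_connecting_coeffMap (hf : Function.Injective f) (hfg : Function.Exact f g)
    (hg : Function.Surjective g) (i : ℕ) :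
    Function.Exact (connecting I M hf hfg hg i) (coeffMap I M f (i + 1)) :=
  exact_yoneda I M _ _ _ _ (shortExact_shortComplexOfExact hf hfg hg).extClass_comp fun X x hx =>
    Ext.covariant_sequence_exact₁ X (shortExact_shortComplexOfExact hf hfg hg) x hx rfl

/-- The connecting map is an isomorphism if the neighbouring middle terms vanish. -/
def connectingEquiv (hf : Function.Injective f) (hfg : Function.Exact f g)
    (hg : Function.Surjective g) (i : ℕ) [Subsingleton (GenLocalCohomology I M B i)]
    [Subsingleton (GenLocalCohomology I M B (i + 1))] :
    GenLocalCohomology I M C i ≃ₗ[R] GenLocalCohomology I M A (i + 1) :=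
  .ofBijective (connecting I M hf hfg hg i)
    ⟨(injective_iff_map_eq_zero _).2 fun x hx => by
        obtain ⟨y, rfl⟩ := (exact_coeffMap_connecting I M hf hfg hg i x).1 hx
        rw [Subsingleton.elim y 0, map_zero],
      fun x => (exact_connecting_coeffMap I M hf hfg hg i x).1 (Subsingleton.elim _ _)⟩

theorem subsingleton_ext_of_injective [Module.Injective R N] (i : ℕ) :
    Subsingleton (ExtMod R M N (i + 1)) :=
  have : Injective (ModuleCat.of R N) := Module.injective_object_of_injective_module R N
  subsingleton_of_forall_eq 0 Ext.eq_zero_of_injective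

theorem subsingleton_genLocalCohomology_of_injective [Module.Injective R N] (i : ℕ) :
    Subsingleton (GenLocalCohomology I M N (i + 1)) :=
  subsingleton_of_forall_eq 0 fun z => by
    obtain ⟨q, x, rfl⟩ := z.exists_of
    have := subsingleton_ext_of_injective (R := R) (M ⧸ (I ^ q • ⊤ : Submodule R M)) (N := N) i
    rw [Subsingleton.elim x 0, map_zero]

/-- Dimension shifting: `Ext^{i+1}(M, C) = 0` iff `Ext^{i+2}(M, A) = 0` for `0 → A → B → C → 0`
exact with `B` injective. -/
theorem subsingleton_ext_succ_iff (hf : Function.Injective f) (hfg : Function.Exact f g)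
    (hg : Function.Surjective g)
    [Module.Injective R B] (i : ℕ) :
    Subsingleton (ExtMod R M C (i + 1)) ↔ Subsingleton (ExtMod R M A (i + 2)) := by
  have h1 := subsingleton_ext_of_injective (R := R) M (N := B) i
  have h2 := subsingleton_ext_of_injective (R := R) M (N := B) (i + 1)
  have hS := shortExact_shortComplexOfExact hf hfg hg
  constructor <;> intro h <;> refine subsingleton_of_forall_eq 0 fun x => ?_
  · obtain ⟨y, rfl⟩ := Ext.covariant_sequence_exact₁ _ hS x (@Subsingleton.elim _ h2 _ _)
      (rfl : (i + 1) + 1 = i + 2)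
    rw [@Subsingleton.elim _ h y 0, Ext.zero_comp]
  · obtain ⟨y, rfl⟩ := Ext.covariant_sequence_exact₃ _ hS x (rfl : (i + 1) + 1 = i + 2)
      (@Subsingleton.elim _ h _ _)
    rw [@Subsingleton.elim _ h1 y 0, Ext.zero_comp]

/-- `Ext^1(M, A) = 0` iff every linear map `M → C` lifts to `B`, for `0 → A → B → C → 0` exact
with `B` injective. -/
theorem subsingleton_ext_one_iff (hf : Function.Injective f) (hfg : Function.Exact f g)
    (hg : Function.Surjective g)
    [Module.Injective R B] :
    Subsingleton (ExtMod R M A 1) ↔ ∀ u : M →ₗ[R] C, ∃ v : M →ₗ[R] B, g ∘ₗ v = u := by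
  have h1 := subsingleton_ext_of_injective (R := R) M (N := B) 0
  have hS := shortExact_shortComplexOfExact hf hfg hg
  constructor
  · intro h u
    obtain ⟨y, hy⟩ := Ext.covariant_sequence_exact₃ _ hS (Ext.mk₀ (ModuleCat.ofHom u))
      (rfl : 0 + 1 = 1) (@Subsingleton.elim _ h _ _)
    obtain ⟨v, rfl⟩ := Ext.homEquiv₀.symm.surjective y
    rw [Ext.homEquiv₀_symm_apply, Ext.mk₀_comp_mk₀] at hy
    have hy' := Ext.homEquiv₀.symm.injective hy
    exact ⟨v.hom, congrArg ModuleCat.Hom.hom hy'⟩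
  · refine fun h => subsingleton_of_forall_eq 0 fun x => ?_
    obtain ⟨y, rfl⟩ := Ext.covariant_sequence_exact₁ _ hS x (@Subsingleton.elim _ h1 _ _)
      (rfl : 0 + 1 = 1)
    obtain ⟨u, rfl⟩ := Ext.homEquiv₀.symm.surjective y
    obtain ⟨v, hv⟩ := h u.hom
    have hu : u = ModuleCat.ofHom v ≫ ModuleCat.ofHom g := by
      ext x
      exact (LinearMap.congr_fun hv x).symm
    -- The product of `g` with the extension class is zero, so a map that lifts to `B` has zero
    -- image in `Ext^1(M, A)`.
    rw [Ext.homEquiv₀_symm_apply, hu, ← Ext.mk₀_comp_mk₀, Ext.comp_assoc_of_second_deg_zero]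
    exact (congrArg (fun z => (Ext.mk₀ (ModuleCat.ofHom v)).comp z (zero_add 1))
      hS.comp_extClass).trans (Ext.comp_zero _ _ _ _ _)

end LongExactSequence

/-! ### Degree zero: maps into the torsion submodule. -/

section DegreeZero

variable (I : Ideal R) (M : Type u) [AddCommGroup M] [Module R M]
  {N P : Type u} [AddCommGroup N] [Module R N] [AddCommGroup P] [Module R P]

/-- The comparison map `H^0_I(M, N) → Hom(M, N)`. -/
def degreeZeroHom : GenLocalCohomology I M N 0 →ₗ[R] (M →ₗ[R] N) :=
  Module.DirectLimit.lift R ℕ _ _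
    (fun q => LinearMap.lcomp R N (Submodule.mkQ (I ^ q • ⊤ : Submodule R M)) ∘ₗ
      (ModuleCat.homLinearEquiv (S := R)).toLinearMap ∘ₗ (Ext.linearEquiv₀ (R := R)).toLinearMap)
    fun p q hpq x => by
      obtain ⟨y, rfl⟩ := Ext.homEquiv₀.symm.surjective x
      rw [extTransition_apply, Ext.homEquiv₀_symm_apply, Ext.mk₀_comp_mk₀]
      have h : ∀ (X : ModuleCat.{u} R) (w : X ⟶ ModuleCat.of R N),
          Ext.linearEquiv₀ (R := R) (Ext.mk₀ w) = w :=
        fun X w => (Ext.linearEquiv₀ (R := R)).apply_symm_apply w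
      simp only [LinearMap.comp_apply, LinearEquiv.coe_coe, h]
      rfl

theorem degreeZeroHom_of (q : ℕ) (u : M ⧸ (I ^ q • ⊤ : Submodule R M) →ₗ[R] N) :
    degreeZeroHom I M (GenLocalCohomology.of I M 0 q (Ext.mk₀ (ModuleCat.ofHom u))) =
      u ∘ₗ Submodule.mkQ _ := by
  refine (Module.DirectLimit.lift_of _ _ _).trans ?_
  have h : Ext.linearEquiv₀ (R := R) (Ext.mk₀ (ModuleCat.ofHom u)) = ModuleCat.ofHom u :=
    (Ext.linearEquiv₀ (R := R)).apply_symm_apply _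
  simp only [LinearMap.comp_apply, LinearEquiv.coe_coe, h]
  rfl

variable {I M} in
theorem GenLocalCohomology.exists_of_linearMap (z : GenLocalCohomology I M N 0) :
    ∃ q u, GenLocalCohomology.of I M 0 q (Ext.mk₀ (ModuleCat.ofHom u)) = z := by
  obtain ⟨q, x, rfl⟩ := z.exists_of
  obtain ⟨u, rfl⟩ := Ext.homEquiv₀.symm.surjective x
  exact ⟨q, u.hom, rfl⟩

theorem degreeZeroHom_coeffMap (f : N →ₗ[R] P) (z : GenLocalCohomology I M N 0) :
    degreeZeroHom I M (coeffMap I M f 0 z) = f ∘ₗ degreeZeroHom I M z := by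
  obtain ⟨q, u, rfl⟩ := z.exists_of_linearMap
  rw [yoneda_of, Ext.mk₀_comp_mk₀, ← ModuleCat.ofHom_comp, degreeZeroHom_of, degreeZeroHom_of,
    LinearMap.comp_assoc]

/-- A class is represented by a map on some `M / I^q M`, and such a map is determined by its
composite with the surjection from `M`. -/
theorem degreeZeroHom_injective : Function.Injective (degreeZeroHom I M (N := N)) := by
  rw [injective_iff_map_eq_zero]
  intro z hz
  obtain ⟨q, u, rfl⟩ := z.exists_of_linearMap
  rw [degreeZeroHom_of] at hz
  have hu : u = 0 := Submodule.linearMap_qext _ hz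
  rw [hu, ModuleCat.ofHom_zero, Ext.mk₀_zero, map_zero]

theorem degreeZeroHom_mem_powTorsion (z : GenLocalCohomology I M N 0) (x : M) :
    degreeZeroHom I M z x ∈ powTorsion I N := by
  obtain ⟨q, u, rfl⟩ := z.exists_of_linearMap
  refine ⟨q, fun a ha => ?_⟩
  rw [degreeZeroHom_of, ← map_smul, LinearMap.comp_apply, Submodule.mkQ_apply,
    (Submodule.Quotient.mk_eq_zero _).2 (Submodule.smul_mem_smul ha Submodule.mem_top), map_zero]

theorem exists_degreeZeroHom_eq [Module.Finite R M] (f : M →ₗ[R] N)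
    (hf : ∀ x, f x ∈ powTorsion I N) : ∃ z, degreeZeroHom I M z = f := by
  obtain ⟨q, hq⟩ := exists_pow_smul_eq_zero I f hf
  have h : (I ^ q • ⊤ : Submodule R M) ≤ LinearMap.ker f :=
    Submodule.smul_le.2 fun a ha x _ => by rw [LinearMap.mem_ker, map_smul, hq a ha]
  exact ⟨_, (degreeZeroHom_of I M q (Submodule.liftQ _ f h)).trans (Submodule.liftQ_mkQ _ _ _)⟩

/-- `H^0_I(M, N) = Hom(M, Γ_I(N))` for `M` finite. -/
def degreeZeroEquiv [Module.Finite R M] :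
    GenLocalCohomology I M N 0 ≃ₗ[R] (M →ₗ[R] powTorsion I N) :=
  .ofBijective
    { toFun z := (degreeZeroHom I M z).codRestrict _ (degreeZeroHom_mem_powTorsion I M z)
      map_add' x y := by ext; simp
      map_smul' c x := by ext; simp }
    ⟨fun x y h => degreeZeroHom_injective I M <| by
        ext m
        exact congrArg Subtype.val (LinearMap.congr_fun h m),
      fun f => by
        obtain ⟨z, hz⟩ := exists_degreeZeroHom_eq I M ((powTorsion I N).subtype ∘ₗ f)
          fun x => (f x).2
        exact ⟨z, by ext m; exact LinearMap.congr_fun hz m⟩⟩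

theorem degreeZeroEquiv_coeffMap [Module.Finite R M] (f : N →ₗ[R] P)
    (z : GenLocalCohomology I M N 0) :
    degreeZeroEquiv I M (coeffMap I M f 0 z) = powTorsionMap I f ∘ₗ degreeZeroEquiv I M z := by
  ext x
  exact LinearMap.congr_fun (degreeZeroHom_coeffMap I M f z) x

/-- `H^0_I(N) = Γ_I(N)`. -/
def localCohomologyZeroEquiv : LocalCohomologyMod I N 0 ≃ₗ[R] powTorsion I N :=
  degreeZeroEquiv I R ≪≫ₗ LinearMap.ringLmapEquivSelf R R (powTorsion I N)

end DegreeZero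

/-! ### Dimension shifting and the collapse in the concentrated case. -/

section DimensionShifting

variable (I : Ideal R) (M : Type u) [AddCommGroup M] [Module R M]
  {N A B C : Type u} [AddCommGroup N] [Module R N] [AddCommGroup A] [Module R A]
  [AddCommGroup B] [Module R B] [AddCommGroup C] [Module R C]

theorem powTorsion_eq_bot [h : Subsingleton (LocalCohomologyMod I N 0)] :
    powTorsion I N = ⊥ :=
  have := (localCohomologyZeroEquiv I (N := N)).symm.toEquiv.subsingleton
  (Submodule.subsingleton_iff_eq_bot).1 this

theorem subsingleton_genLocalCohomology_zero (h : powTorsion I N = ⊥) :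
    Subsingleton (GenLocalCohomology I M N 0) :=
  subsingleton_of_forall_eq 0 fun z => degreeZeroHom_injective I M <| by
    ext x
    simpa [h] using degreeZeroHom_mem_powTorsion I M z x

theorem subsingleton_ext_zero_iff : Subsingleton (ExtMod R M N 0) ↔ Subsingleton (M →ₗ[R] N) :=
  (Ext.homEquiv₀.trans ModuleCat.homEquiv).subsingleton_congr

theorem powTorsionMap_injective {f : A →ₗ[R] B} (hf : Function.Injective f) :
    Function.Injective (powTorsionMap I f) :=
  fun _ _ h => Subtype.ext (hf (congrArg Subtype.val h))

theorem powTorsionMap_exact {f : A →ₗ[R] B} {g : B →ₗ[R] C} (hf : Function.Injective f)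
    (hfg : Function.Exact f g) : Function.Exact (powTorsionMap I f) (powTorsionMap I g) := by
  intro x
  constructor
  · intro hx
    obtain ⟨y, hy⟩ := (hfg x).1 (congrArg Subtype.val hx)
    exact ⟨⟨y, mem_powTorsion_of_injective I f hf (hy ▸ x.2)⟩, Subtype.ext hy⟩
  · rintro ⟨y, rfl⟩
    exact Subtype.ext ((hfg _).2 ⟨y, rfl⟩)

/-- Every linear map `M → Γ_I(C)` lifts to `Γ_I(B)` if `H^1_I(M, A) = 0`. -/
theorem exists_powTorsionMap_comp_eq [Module.Finite R M] {f : A →ₗ[R] B} {g : B →ₗ[R] C}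
    (hf : Function.Injective f) (hfg : Function.Exact f g) (hg : Function.Surjective g)
    [Subsingleton (GenLocalCohomology I M A 1)] (u : M →ₗ[R] powTorsion I C) :
    ∃ v : M →ₗ[R] powTorsion I B, powTorsionMap I g ∘ₗ v = u := by
  obtain ⟨z, rfl⟩ := (degreeZeroEquiv I M).surjective u
  obtain ⟨w, rfl⟩ := (exact_coeffMap_connecting I M hf hfg hg 0 z).1
    (@Subsingleton.elim (GenLocalCohomology I M A 1) _ _ _)
  exact ⟨degreeZeroEquiv I M w, (degreeZeroEquiv_coeffMap I M g w).symm⟩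

/-- Elements of `Γ_I(C)` are maps `R → Γ_I(C)`, so this is the lifting property for `M = R`. -/
theorem powTorsionMap_surjective {f : A →ₗ[R] B} {g : B →ₗ[R] C}
    (hf : Function.Injective f) (hfg : Function.Exact f g) (hg : Function.Surjective g)
    [Subsingleton (LocalCohomologyMod I A 1)] : Function.Surjective (powTorsionMap I g) := by
  intro x
  obtain ⟨v, hv⟩ := exists_powTorsionMap_comp_eq I R hf hfg hg (LinearMap.toSpanSingleton R _ x)
  exact ⟨v 1, (LinearMap.congr_fun hv 1).trans (by simp)⟩

/-- `H^1_I(M, A) = 0` iff every linear map `M → Γ_I(C)` lifts to `Γ_I(B)`, for `0 → A → B → C → 0`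
exact with `B` injective. -/
theorem subsingleton_genLocalCohomology_one_iff [Module.Finite R M] {f : A →ₗ[R] B}
    {g : B →ₗ[R] C} (hf : Function.Injective f) (hfg : Function.Exact f g)
    (hg : Function.Surjective g) [Module.Injective R B] :
    Subsingleton (GenLocalCohomology I M A 1) ↔
      ∀ u : M →ₗ[R] powTorsion I C, ∃ v : M →ₗ[R] powTorsion I B, powTorsionMap I g ∘ₗ v = u := by
  refine ⟨fun _ => exists_powTorsionMap_comp_eq I M hf hfg hg, fun h =>
    subsingleton_of_forall_eq 0 fun z => ?_⟩
  have := subsingleton_genLocalCohomology_of_injective I M (N := B) 0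
  obtain ⟨w, rfl⟩ := (exact_connecting_coeffMap I M hf hfg hg 0 z).1
    (@Subsingleton.elim (GenLocalCohomology I M B 1) _ _ _)
  obtain ⟨v, hv⟩ := h (degreeZeroEquiv I M w)
  refine (exact_coeffMap_connecting I M hf hfg hg 0 w).2 ⟨(degreeZeroEquiv I M).symm v, ?_⟩
  apply (degreeZeroEquiv I M).injective
  rw [degreeZeroEquiv_coeffMap, LinearEquiv.apply_symm_apply, hv]

/-- If `H^j_I(N) = 0` for all `j > 0`, then `H^i_I(M, N)` and `Ext^i(M, Γ_I(N))` vanish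
simultaneously. -/
theorem subsingleton_genLocalCohomology_iff_ext_powTorsion [IsNoetherianRing R]
    [Module.Finite R M] (i : ℕ) :
    ∀ (N : Type u) [AddCommGroup N] [Module R N],
      (∀ j, Subsingleton (LocalCohomologyMod I N (j + 1))) →
      (Subsingleton (GenLocalCohomology I M N i) ↔
        Subsingleton (ExtMod R M (powTorsion I N) i)) := by
  induction i with
  | zero =>
    intro N _ _ _
    rw [subsingleton_ext_zero_iff]
    exact (degreeZeroEquiv I M).toEquiv.subsingleton_congr
  | succ i ih =>
    intro N _ _ hN
    obtain ⟨E, _, _, f, hE, hf⟩ := exists_injective_embedding (R := R) N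
    have hg := Submodule.mkQ_surjective (LinearMap.range f)
    have hfg := LinearMap.exact_map_mkQ_range f
    have := hN 0
    have := injective_powTorsion I (N := E)
    have hf' := powTorsionMap_injective I hf
    have hfg' := powTorsionMap_exact I hf hfg
    have hg' := powTorsionMap_surjective I hf hfg hg
    -- Degree 1 is separate: degree-zero terms of the injective module need not vanish, so the
    -- connecting map need not be an isomorphism there. Both sides reduce to the same lifting
    -- problem instead.
    cases i with
    | zero =>
      rw [subsingleton_ext_one_iff M hf' hfg' hg']
      exact subsingleton_genLocalCohomology_one_iff I M hf hfg hg
    | succ i =>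
      have hM := subsingleton_genLocalCohomology_of_injective I M (N := E)
      have hR := subsingleton_genLocalCohomology_of_injective I R (N := E)
      have := hM i
      have := hM (i + 1)
      rw [← subsingleton_ext_succ_iff M hf' hfg' hg',
        ← (connectingEquiv I M hf hfg hg (i + 1)).toEquiv.subsingleton_congr]
      -- The cokernel inherits the hypothesis: `H^{j+1}_I(C) ≅ H^{j+2}_I(N) = 0`.
      refine ih _ fun j => ?_
      have := hR j
      have := hR (j + 1)
      have := hN (j + 1)
      exact (connectingEquiv I R hf hfg hg (j + 1)).toEquiv.subsingleton

theorem subsingleton_ext_congr (e : A ≃ₗ[R] B) (i : ℕ) :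
    Subsingleton (ExtMod R M A i) ↔ Subsingleton (ExtMod R M B i) := by
  have key : ∀ {A B : Type u} [AddCommGroup A] [Module R A] [AddCommGroup B] [Module R B]
      (_ : A ≃ₗ[R] B), Subsingleton (ExtMod R M A i) → Subsingleton (ExtMod R M B i) := by
    intro A B _ _ _ _ e _
    refine subsingleton_of_forall_eq 0 fun x => ?_
    have h : ModuleCat.ofHom e.symm.toLinearMap ≫ ModuleCat.ofHom e.toLinearMap = 𝟙 _ := by
      ext x
      exact e.apply_symm_apply x
    rw [← Ext.comp_mk₀_id x, ← h, ← Ext.mk₀_comp_mk₀, ← Ext.comp_assoc_of_third_deg_zero,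
      Subsingleton.elim (x.comp _ (add_zero i)) 0, Ext.zero_comp]
  exact ⟨key e, key e.symm⟩

/-- If `H^j_I(N) = 0` for all `j ≠ n`, then `H^i_I(M, N) = 0` for `i < n`, and `H^{i+n}_I(M, N)`
and `Ext^i(M, H^n_I(N))` vanish simultaneously. -/
theorem genLocalCohomology_of_concentrated [IsNoetherianRing R] [Module.Finite R M] (n : ℕ) :
    ∀ (N : Type u) [AddCommGroup N] [Module R N],
      (∀ j, j ≠ n → Subsingleton (LocalCohomologyMod I N j)) →
      (∀ i < n, Subsingleton (GenLocalCohomology I M N i)) ∧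
        ∀ i, (Subsingleton (GenLocalCohomology I M N (i + n)) ↔
          Subsingleton (ExtMod R M (LocalCohomologyMod I N n) i)) := by
  induction n with
  | zero =>
    intro N _ _ hN
    refine ⟨fun i hi => absurd hi (Nat.not_lt_zero i), fun i => ?_⟩
    rw [subsingleton_ext_congr M (localCohomologyZeroEquiv I)]
    exact subsingleton_genLocalCohomology_iff_ext_powTorsion I M i N
      fun j => hN (j + 1) j.succ_ne_zero
  | succ n ih =>
    intro N _ _ hN
    have := hN 0 n.succ_ne_zero.symm
    have hN0 := powTorsion_eq_bot I (N := N)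
    obtain ⟨E, _, _, f, hE, hf, hE0⟩ := exists_injective_embedding_of_powTorsion_eq_bot I hN0
    have hg := Submodule.mkQ_surjective (LinearMap.range f)
    have hfg := LinearMap.exact_map_mkQ_range f
    have hv : ∀ (X : Type u) [AddCommGroup X] [Module R X] (i : ℕ),
        Subsingleton (GenLocalCohomology I X E i) := by
      intro X _ _ i
      cases i with
      | zero => exact subsingleton_genLocalCohomology_zero I X hE0
      | succ i => exact subsingleton_genLocalCohomology_of_injective I X i
    have hM := hv M
    have hR := hv R
    -- Since `H^j_I(E/N) ≅ H^{j+1}_I(N)` for every `j`, the quotient is concentrated in degree `n`.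
    obtain ⟨h1, h2⟩ := ih (E ⧸ LinearMap.range f) fun j hj =>
      have := hN (j + 1) (by lia)
      (connectingEquiv I R hf hfg hg j).toEquiv.subsingleton
    refine ⟨fun i hi => ?_, fun i => ?_⟩
    · cases i with
      | zero => exact subsingleton_genLocalCohomology_zero I M hN0
      | succ i =>
        have := h1 i (by lia)
        exact (connectingEquiv I M hf hfg hg i).symm.toEquiv.subsingleton
    · rw [← subsingleton_ext_congr M (connectingEquiv I R hf hfg hg n), ← h2 i]
      exact (connectingEquiv I M hf hfg hg (i + n)).symm.toEquiv.subsingleton_congr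

end DimensionShifting

/-! ### Passing from vanishing to the numerical invariants. -/

section Invariants

variable {I : Ideal R} {N : Type u} [AddCommGroup N] [Module R N]

/-- The local cohomology of a relative Cohen-Macaulay module is concentrated in a single degree. -/
theorem IsCohenMacaulay.exists_concentrated (hN : IsCohenMacaulay I N) :
    ∃ n : ℕ, cd I N = ((n : ℕ∞) : WithBot ℕ∞) ∧
      ∀ j, j ≠ n → Subsingleton (LocalCohomologyMod I N j) := by
  have hle : ∀ j, Nontrivial (LocalCohomologyMod I N j) →
      cd I N ≤ ((j : ℕ∞) : WithBot ℕ∞) ∧ ((j : ℕ∞) : WithBot ℕ∞) ≤ cd I N := fun j hj =>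
    ⟨hN ▸ iInf₂_le j hj, le_iSup₂_of_le j hj le_rfl⟩
  by_cases h : ∃ n, Nontrivial (LocalCohomologyMod I N n)
  · obtain ⟨n, hn⟩ := h
    have hcd := le_antisymm (hle n hn).1 (hle n hn).2
    refine ⟨n, hcd, fun j hj => not_nontrivial_iff_subsingleton.1 fun hj' => hj ?_⟩
    have := le_antisymm (hle j hj').1 (hle j hj').2
    rw [hcd] at this
    exact_mod_cast this.symm
  -- If all local cohomology vanished, depth would be `+∞` and cd would be `-∞`, so the
  -- Cohen–Macaulay hypothesis excludes this case.
  · have h1 : depth I N = ⊤ := iInf₂_eq_top.2 fun i hi => absurd ⟨i, hi⟩ h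
    have h2 : cd I N = ⊥ := iSup₂_eq_bot.2 fun i hi => absurd ⟨i, hi⟩ h
    exact absurd (h1.symm.trans (Eq.trans hN h2)) top_ne_bot

theorem extDim_eq_bot (M : Type u) [AddCommGroup M] [Module R M] [Subsingleton N] :
    extDim R M N = ⊥ := by
  refine iSup₂_eq_bot.2 fun i hi => absurd hi (not_nontrivial_iff_subsingleton.2 ?_)
  refine subsingleton_of_forall_eq 0 fun x => ?_
  have h : 𝟙 (ModuleCat.of R N) = 0 := by
    ext x
    exact Subsingleton.elim _ _
  rw [← Ext.comp_mk₀_id x, h, Ext.mk₀_zero, Ext.comp_zero]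

theorem hInv_of_concentrated (M : Type u) [AddCommGroup M] [Module R M] {n : ℕ}
    (h : ∀ j, j ≠ n → Subsingleton (LocalCohomologyMod I N j)) :
    hInv I M N = extDim R M (LocalCohomologyMod I N n) := by
  refine le_antisymm (iSup_le fun q => ?_) (le_iSup (fun q => extDim R M _) n)
  by_cases hq : q = n
  · rw [hq]
  · have := h q hq
    rw [extDim_eq_bot]
    exact bot_le

theorem iSup_add_natCast {p q : ℕ → Prop} {n : ℕ} (h1 : ∀ i < n, ¬ p i)
    (h2 : ∀ i, p (i + n) ↔ q i) :
    (⨆ (i : ℕ) (_ : p i), ((i : ℕ∞) : WithBot ℕ∞)) =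
      ((n : ℕ∞) : WithBot ℕ∞) + ⨆ (i : ℕ) (_ : q i), ((i : ℕ∞) : WithBot ℕ∞) := by
  refine le_antisymm (iSup₂_le fun i hi => ?_) ?_
  · obtain ⟨k, rfl⟩ := Nat.exists_eq_add_of_le' (not_lt.1 fun hin => h1 i hin hi)
    rw [add_comm k, Nat.cast_add, WithBot.coe_add]
    gcongr
    exact le_iSup₂_of_le k ((h2 k).1 hi) le_rfl
  · have hp : ∀ i, q i → ((i + n : ℕ∞) : WithBot ℕ∞) ≤
        ⨆ (i : ℕ) (_ : p i), ((i : ℕ∞) : WithBot ℕ∞) := fun i hi =>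
      le_iSup₂_of_le (i + n) ((h2 i).2 hi) (by rw [Nat.cast_add])
    by_cases hq : ∃ i, q i
    · obtain ⟨k, hk⟩ := hq
      generalize (⨆ (i : ℕ) (_ : p i), ((i : ℕ∞) : WithBot ℕ∞)) = b at hp
      induction b with
      | bot => exact absurd (hp k hk) (WithBot.not_coe_le_bot _)
      | coe b =>
        have hp' : ∀ i, q i → (i + n : ℕ∞) ≤ b := fun i hi => WithBot.coe_le_coe.1 (hp i hi)
        -- Nonemptiness of `q` gives `n ≤ b`, without which the truncated difference `b - n` would
        -- not add back to `b`.
        have hnb : (n : ℕ∞) ≤ b := le_add_self.trans (hp' k hk)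
        calc ((n : ℕ∞) : WithBot ℕ∞) + ⨆ (i : ℕ) (_ : q i), ((i : ℕ∞) : WithBot ℕ∞)
            ≤ ((n : ℕ∞) : WithBot ℕ∞) + ((b - n : ℕ∞) : WithBot ℕ∞) := by
              gcongr
              exact iSup₂_le fun i hi => WithBot.coe_le_coe.2
                (ENat.le_sub_of_add_le_right (ENat.natCast_ne_top n) (hp' i hi))
          _ = b := by rw [← WithBot.coe_add, add_tsub_cancel_of_le hnb]
    · have : (⨆ (i : ℕ) (_ : q i), ((i : ℕ∞) : WithBot ℕ∞)) = ⊥ :=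
        iSup₂_eq_bot.2 fun i hi => absurd ⟨i, hi⟩ hq
      rw [this, WithBot.add_bot]
      exact bot_le

end Invariants

end RelCM

end

theorem proposition2p3 (R : Type u) [CommRing R] [IsNoetherianRing R] (I : Ideal R) (hI : I ≠ ⊤)
    (M N : Type u) [AddCommGroup M] [Module R M] [Module.Finite R M]
    [AddCommGroup N] [Module R N] (hN : RelCM.IsCohenMacaulay I N) :
    RelCM.cdPair I M N = RelCM.cd I N + RelCM.hInv I M N ∧
      ((∃ i : ℕ, Nontrivial (RelCM.GenLocalCohomology I M N i)) →
        RelCM.cd I N ≤ RelCM.cdPair I M N) := by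
  obtain ⟨n, hcd, hconc⟩ := hN.exists_concentrated
  obtain ⟨h1, h2⟩ := RelCM.genLocalCohomology_of_concentrated I M n N hconc
  have h1' : ∀ i < n, ¬ Nontrivial (RelCM.GenLocalCohomology I M N i) := fun i hi =>
    not_nontrivial_iff_subsingleton.2 (h1 i hi)
  refine ⟨?_, fun ⟨i, hi⟩ => ?_⟩
  · rw [hcd, RelCM.hInv_of_concentrated M hconc]
    refine RelCM.iSup_add_natCast h1' fun i => ?_
    rw [← not_iff_not, not_nontrivial_iff_subsingleton, not_nontrivial_iff_subsingleton, h2 i]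
  · rw [hcd]
    refine le_iSup₂_of_le i hi ?_
    -- A nonvanishing degree `i` cannot lie below `n = cd_I N`.
    exact_mod_cast not_lt.1 fun hin => h1' i hin hi
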